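/- Let $\Phi$ be a commutative unital ring and let $A=(A^+,A^-)$ be an associative pair over $\Phi$, that is, a pair of $\Phi$-modules with trilinear products $A^\sigma\times A^{-\sigma}\times A^\sigma\to A^\sigma$ ($\sigma=\pm$) satisfying $(xyz)uv=x(yzu)v=xy(zuv)$. Suppose that $A$ is primitive, i.e. has a faithful irreducible right module $(M^+,M^-)$ (bilinear maps $M^\sigma\times A^{-\sigma}\to M^{-\sigma}$ with $((mx)y)z=m(xyz)$; irreducible: $M^{\sigma}A^{-\sigma}\neq 0$ for both signs and the only submodules are $0$ and $M$; faithful: $M^{-\sigma}x=0$ with $x\in A^\sigma$ implies $x=0$). Suppose that $A$ satisfies a homotope polynomial identity of degree $d$: there is an element $f(x_1,\dots,x_n)$ of the free nonunital associative $\Phi$-algebra which is monic of degree $d$ (its degree is $d$ and some monomial of degree $d$ has coefficient $1$) and such that, for $\sigma=\pm$ and all $a\in A^{-\sigma}$, $f$ vanishes identically on the homotope algebra $(A^\sigma)^{(a)}$, i.e. on $A^\sigma$ with the product $x\cdot y=xay$. Then $A$ has finite capacity, and its capacity is at most $\lfloor d/2\rfloor$. Here an idempotent $e=(e^+,e^-)$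 of $A$ (that is, $e^\sigma e^{-\sigma}e^\sigma=e^\sigma$) has Peirce spaces $A_{11}^\sigma(e)=e^\sigma A^{-\sigma}e^\sigma$ and $A_{00}^\sigma(e)=\{x\in A^\sigma: e^\sigma e^{-\sigma}x=0=xe^{-\sigma}e^\sigma\}$; it is a division idempotent if $e\ne 0$ and for every nonzero $x\in A_{11}^\sigma(e)$, $\sigma=\pm$, the map $y\mapsto xyx$ is a bijection $A_{11}^{-\sigma}(e)\to A_{11}^\sigma(e)$. A frame is a finite family $e_1,\dots,e_n$ of division idempotents which are pairwise orthogonal ($e_j\in A_{00}(e_i)$ for $i\ne j$) and satisfy $\bigcap_i A_{00}^\sigma(e_i)=0$ for $\sigma=\pm$. The capacity of $A$ is the minimum of the lengths of its frames, and $\infty$ if there is no frame. -/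

import Mathlib

universe u v w v' w'

/-- An associative pair `(P, N) = (A⁺, A⁻)` over the commutative ring `Φ`: trilinear products
`A⁺ × A⁻ × A⁺ → A⁺` and `A⁻ × A⁺ × A⁻ → A⁻` with
`(xyz)uv = x(yzu)v = xy(zuv)` for both signs. -/
structure AssociativePair (Φ : Type u) (P : Type v) (N : Type w) [CommRing Φ]
    [AddCommGroup P] [Module Φ P] [AddCommGroup N] [Module Φ N] where
  tp : P →ₗ[Φ] N →ₗ[Φ] P →ₗ[Φ] P
  tm : N →ₗ[Φ] P →ₗ[Φ] N →ₗ[Φ] N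
  tp_assoc_left : ∀ (x : P) (y : N) (z : P) (s : N) (t : P),
    tp (tp x y z) s t = tp x (tm y z s) t
  tp_assoc_right : ∀ (x : P) (y : N) (z : P) (s : N) (t : P),
    tp x (tm y z s) t = tp x y (tp z s t)
  tm_assoc_left : ∀ (x : N) (y : P) (z : N) (s : P) (t : N),
    tm (tm x y z) s t = tm x (tp y z s) t
  tm_assoc_right : ∀ (x : N) (y : P) (z : N) (s : P) (t : N),
    tm x (tp y z s) t = tm x y (tm z s t)

namespace AssociativePair

section Basic

variable {Φ : Type u} {P : Type v} {N : Type w} [CommRing Φ]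
  [AddCommGroup P] [Module Φ P] [AddCommGroup N] [Module Φ N]

/-- The opposite-sign pair `(A⁻, A⁺)`. It is used to state conditions for both signs. -/
def swap (A : AssociativePair Φ P N) : AssociativePair Φ N P where
  tp := A.tm
  tm := A.tp
  tp_assoc_left := A.tm_assoc_left
  tp_assoc_right := A.tm_assoc_right
  tm_assoc_left := A.tp_assoc_left
  tm_assoc_right := A.tp_assoc_right

/-! ### Modules and primitivity -/

/-- A right module `(M⁺, M⁻)` over the associative pair `A`: bilinear maps
`M⁺ × A⁻ → M⁻` and `M⁻ × A⁺ → M⁺` with `((mx)y)z = m(xyz)`. -/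
structure RightModule (A : AssociativePair Φ P N) (Mp : Type v') (Mm : Type w')
    [AddCommGroup Mp] [Module Φ Mp] [AddCommGroup Mm] [Module Φ Mm] where
  actp : Mp →ₗ[Φ] N →ₗ[Φ] Mm
  actm : Mm →ₗ[Φ] P →ₗ[Φ] Mp
  actp_assoc : ∀ (m : Mp) (x : N) (y : P) (z : N),
    actp (actm (actp m x) y) z = actp m (A.tm x y z)
  actm_assoc : ∀ (m : Mm) (x : P) (y : N) (z : P),
    actm (actp (actm m x) y) z = actm m (A.tp x y z)

/-- `M` is irreducible: `M⁺A⁻ ≠ 0`, `M⁻A⁺ ≠ 0`, and its only submodules are `0` and `M`. -/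
def RightModule.IsIrreducible {A : AssociativePair Φ P N} {Mp : Type v'} {Mm : Type w'}
    [AddCommGroup Mp] [Module Φ Mp] [AddCommGroup Mm] [Module Φ Mm]
    (M : A.RightModule Mp Mm) : Prop :=
  (∃ (m : Mp) (x : N), M.actp m x ≠ 0) ∧ (∃ (m : Mm) (x : P), M.actm m x ≠ 0) ∧
  ∀ (Sp : Submodule Φ Mp) (Sm : Submodule Φ Mm),
    (∀ m ∈ Sp, ∀ x : N, M.actp m x ∈ Sm) → (∀ m ∈ Sm, ∀ x : P, M.actm m x ∈ Sp) →
    (Sp = ⊥ ∧ Sm = ⊥) ∨ (Sp = ⊤ ∧ Sm = ⊤)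

/-- `M` is faithful: an element of `A⁺` (`A⁻`) annihilating all of `M⁻` (`M⁺`) is zero. -/
def RightModule.IsFaithful {A : AssociativePair Φ P N} {Mp : Type v'} {Mm : Type w'}
    [AddCommGroup Mp] [Module Φ Mp] [AddCommGroup Mm] [Module Φ Mm]
    (M : A.RightModule Mp Mm) : Prop :=
  (∀ x : N, (∀ m : Mp, M.actp m x = 0) → x = 0) ∧
  (∀ x : P, (∀ m : Mm, M.actm m x = 0) → x = 0)

/-- `A` is (right) primitive: it has a faithful irreducible right module. -/
def IsPrimitive (A : AssociativePair Φ P N) : Prop :=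
  ∃ (Mp : Type v') (Mm : Type w') (_ : AddCommGroup Mp) (_ : Module Φ Mp)
    (_ : AddCommGroup Mm) (_ : Module Φ Mm) (M : A.RightModule Mp Mm),
    M.IsIrreducible ∧ M.IsFaithful

/-! ### Homotopes and homotope polynomial identities -/

/-- The underlying module `A⁺` of the homotope algebra `(A⁺)^{(a)}`, for `a ∈ A⁻`. -/
def Homotope (_A : AssociativePair Φ P N) (_a : N) : Type v := P

instance (A : AssociativePair Φ P N) (a : N) : AddCommGroup (A.Homotope a) :=
  inferInstanceAs (AddCommGroup P)

instance (A : AssociativePair Φ P N) (a : N) : Module Φ (A.Homotope a) :=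
  inferInstanceAs (Module Φ P)

/-- The product `x · y = x a y` of the homotope algebra. -/
instance (A : AssociativePair Φ P N) (a : N) : Mul (A.Homotope a) :=
  ⟨fun x y => A.tp x a y⟩

theorem homotope_mul_def (A : AssociativePair Φ P N) (a : N) (x y : A.Homotope a) :
    x * y = A.tp x a y := rfl

instance (A : AssociativePair Φ P N) (a : N) : NonUnitalRing (A.Homotope a) where
  left_distrib x y z := (A.tp x a).map_add y z
  right_distrib x y z := LinearMap.congr_fun (A.tp.map_add₂ x y a) z
  zero_mul x := LinearMap.congr_fun (A.tp.map_zero₂ a) x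
  mul_zero x := (A.tp x a).map_zero
  mul_assoc x y z := (A.tp_assoc_left x a y a z).trans (A.tp_assoc_right x a y a z)

instance (A : AssociativePair Φ P N) (a : N) : IsScalarTower Φ (A.Homotope a) (A.Homotope a) where
  smul_assoc c x y := LinearMap.congr_fun (A.tp.map_smul₂ c x a) y

instance (A : AssociativePair Φ P N) (a : N) :
    SMulCommClass Φ (A.Homotope a) (A.Homotope a) where
  smul_comm c x y := ((A.tp x a).map_smul c y).symm

end Basic

/-- The free (nonunital) associative `Φ`-algebra `FA[X]` on the countable set
`X = {x_0, x_1, x_2, …}`: the semigroup algebra of the free semigroup on `X`. -/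
abbrev FA (Φ : Type u) [CommRing Φ] : Type u := MonoidAlgebra Φ (FreeSemigroup ℕ)

/-- `f` is monic of degree `d`: its monomials have length at most `d`, and some monomial of
length `d` has coefficient `1`. -/
def FA.IsMonicOfDegree {Φ : Type u} [CommRing Φ] (f : FA Φ) (d : ℕ) : Prop :=
  (∀ m : FreeSemigroup ℕ, f.coeff m ≠ 0 → m.length ≤ d) ∧
  ∃ m : FreeSemigroup ℕ, m.length = d ∧ f.coeff m = 1

section Identities

variable {Φ : Type u} {P : Type v} {N : Type w} [CommRing Φ]
  [AddCommGroup P] [Module Φ P] [AddCommGroup N] [Module Φ N]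

/-- The value `f(a; x_0, x_1, …) ∈ A⁺` of the homotope polynomial `f(z; x_0, x_1, …)` at `a ∈ A⁻`,
`x_i ∈ A⁺`: the image of `f` under the algebra homomorphism `FA[X] → (A⁺)^{(a)}` which sends the
variables to the `x_i`. So a monomial `x_{i} x_{j} ⋯ x_{k}` takes the value
`x_i a x_j a ⋯ a x_k`. -/
noncomputable def homotopeEval (A : AssociativePair Φ P N) (f : FA Φ) (a : N) (x : ℕ → P) : P :=
  let xs : ℕ → A.Homotope a := x
  MonoidAlgebra.liftMagma Φ (FreeSemigroup.lift xs) f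

/-- `A` satisfies the homotope polynomial identity `f`: the homotope polynomial of `f` vanishes
under all substitutions `z ↦ a ∈ A^{-σ}`, `x_i ∈ A^σ`, for both signs `σ`. -/
def IsHomotopeIdentity (A : AssociativePair Φ P N) (f : FA Φ) : Prop :=
  (∀ (a : N) (x : ℕ → P), A.homotopeEval f a x = 0) ∧
  (∀ (a : P) (x : ℕ → N), A.swap.homotopeEval f a x = 0)

/-- `A` satisfies a homotope-PI of degree `d`. -/
def SatisfiesHPI (A : AssociativePair Φ P N) (d : ℕ) : Prop :=
  ∃ f : FA Φ, FA.IsMonicOfDegree f d ∧ A.IsHomotopeIdentity f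

/-! ### Idempotents, Peirce spaces, capacity -/

/-- `e = (e⁺, e⁻)` is an idempotent: `e⁺e⁻e⁺ = e⁺` and `e⁻e⁺e⁻ = e⁻`. -/
def IsIdempotent (A : AssociativePair Φ P N) (e : P × N) : Prop :=
  A.tp e.1 e.2 e.1 = e.1 ∧ A.tm e.2 e.1 e.2 = e.2

/-- The `+`-part `e⁺A⁻e⁺` of the Peirce space `A₁₁(e)`. -/
def peirceOne (A : AssociativePair Φ P N) (e : P × N) : Set P :=
  {x | ∃ y : N, x = A.tp e.1 y e.1}

/-- The `+`-part `{x | e⁺e⁻x = 0 = xe⁻e⁺}` of the Peirce space `A₀₀(e)`. -/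
def peirceZero (A : AssociativePair Φ P N) (e : P × N) : Set P :=
  {x | A.tp e.1 e.2 x = 0 ∧ A.tp x e.2 e.1 = 0}

/-- `e` is a division idempotent: `e` is nonzero and `A₁₁(e)` is a division pair, that is, every
nonzero `x ∈ A₁₁(e)^σ` is invertible: `y ↦ xyx` is a bijection `A₁₁(e)^{-σ} → A₁₁(e)^σ`. -/
def IsDivisionIdempotent (A : AssociativePair Φ P N) (e : P × N) : Prop :=
  A.IsIdempotent e ∧ e ≠ 0 ∧
  (∀ x ∈ A.peirceOne e, x ≠ 0 →
    Set.BijOn (fun y => A.tp x y x) (A.swap.peirceOne e.swap) (A.peirceOne e)) ∧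
  (∀ x ∈ A.swap.peirceOne e.swap, x ≠ 0 →
    Set.BijOn (fun y => A.tm x y x) (A.peirceOne e) (A.swap.peirceOne e.swap))

/-- A frame of length `n`: pairwise orthogonal division idempotents `e_1, …, e_n` (orthogonality:
`e_j ∈ A₀₀(e_i)` for `i ≠ j`) whose common Peirce space `⋂ A₀₀(e_i)` is zero. -/
def IsFrame (A : AssociativePair Φ P N) {n : ℕ} (e : Fin n → P × N) : Prop :=
  (∀ i, A.IsDivisionIdempotent (e i)) ∧
  (∀ i j, i ≠ j → (e j).1 ∈ A.peirceZero (e i) ∧ (e j).2 ∈ A.swap.peirceZero (e i).swap) ∧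
  (∀ x : P, (∀ i, x ∈ A.peirceZero (e i)) → x = 0) ∧
  (∀ x : N, (∀ i, x ∈ A.swap.peirceZero (e i).swap) → x = 0)

/-- The capacity of `A`: the least length of a finite frame, and `∞` if there is none. -/
noncomputable def capacity (A : AssociativePair Φ P N) : ℕ∞ :=
  sInf {c : ℕ∞ | ∃ (n : ℕ) (e : Fin n → P × N), A.IsFrame e ∧ c = (n : ℕ∞)}

end Identities

end AssociativePair

/-! Fix a faithful irreducible module `(M⁺, M⁻)`. Call a finite family in `M^σ` interpolating if
elements of `A^{-σ}` can send it to arbitrary targets; this plays the role of linear independence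
over a division ring, without constructing one. Density holds in the form `extend_interpolates`: a
family that cannot be enlarged in number has zero annihilator in `A^{-σ}`.

If both signs had interpolating families `m`, `n` with `d / 2 + 1` members, choose `a` with `n_j a =
m_j`. In the homotope at `a`, suitable elements act on the `m_j` as the matrix units `e₀₀, e₀₁, e₁₁,
e₁₂, …`. The product of the first `d` of them, in this order, carries `m₀` to `m_{d/2}`, and every
other arrangement kills `m₀`. Linearizing the identity along its monic word of length `d` then
forces `m_{d/2} = 0`, which is absurd (`not_interpolates_of_identity`).

Hence for some `n ≤ d / 2` both signs have families of size `n`, but not both of size `n + 1`. One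
of the two families has zero annihilator, and the diagonal matrix units built from the pair form a
frame of length `n` (`exists_isFrame`). -/

namespace AssociativePair

/-! ### Multilinearization of an identity -/

/-- The letters of a word of the free semigroup. -/
def letters {α : Type*} (m : FreeSemigroup α) : List α := m.head :: m.tail

theorem letters_injective {α : Type*} : Function.Injective (letters (α := α)) := by
  rintro ⟨x, l⟩ ⟨y, l'⟩ h
  simp only [letters, List.cons.injEq] at h
  rw [h.1, h.2]

/-- The sum expands a product over positions whose factor is `-1` where `p` holds and `-1 + 1 = 0`
where it fails. -/
theorem sum_supersets_neg_one_pow {R : Type*} [CommRing R] {d : ℕ} (p : Fin d → Prop)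
    [DecidablePred p] :
    (∑ S : Finset (Fin d), (-1 : R) ^ S.card * if ∀ i, p i → i ∈ S then 1 else 0) =
      if ∀ i, p i then (-1) ^ d else 0 := by
  have h := Fintype.prod_add (fun _ : Fin d => (-1 : R)) (fun i => if p i then 0 else 1)
  have h2 : (∑ S : Finset (Fin d), (-1 : R) ^ S.card * if ∀ i, p i → i ∈ S then 1 else 0) =
      ∏ i : Fin d, ((-1 : R) + if p i then 0 else 1) := by
    rw [h]
    refine Finset.sum_congr rfl fun S _ => ?_
    rw [Finset.prod_const]
    congr 1
    split_ifs with hS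
    · refine (Finset.prod_eq_one fun i hi => if_neg fun hp => ?_).symm
      exact (Finset.mem_compl.1 hi) (hS i hp)
    · push Not at hS
      obtain ⟨i, hp, hi⟩ := hS
      refine (Finset.prod_eq_zero (Finset.mem_compl.2 hi) ?_).symm
      simp [hp]
  rw [h2]
  split_ifs with hp
  · simp [hp]
  · push Not at hp
    obtain ⟨i, hi⟩ := hp
    exact Finset.prod_eq_zero (Finset.mem_univ i) (by simp [hi])

section Linearization

variable {Φ : Type*} [CommRing Φ] {V B : Type*} [AddCommGroup V] [Module Φ V] [Ring B] [Algebra Φ B]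

open Classical in
/-- Inclusion–exclusion for noncommutative products: the alternating sum over all sets `S` of
positions keeps exactly the products which involve every position. -/
theorem sum_neg_one_pow_prod_ofFn (ρ : V →ₗ[Φ] B) {d l : ℕ} (u : Fin d → V) (i : Fin d → ℕ)
    (L : Fin l → ℕ) :
    ∑ S : Finset (Fin d), (-1 : Φ) ^ S.card •
        (List.ofFn fun q => ρ (∑ p ∈ S with i p = L q, u p)).prod =
      (-1 : Φ) ^ d • ∑ r : Fin l → Fin d with Function.Surjective r ∧ ∀ q, i (r q) = L q,
        (List.ofFn fun q => ρ (u (r q))).prod := by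
  have h1 : ∀ S : Finset (Fin d), (List.ofFn fun q => ρ (∑ p ∈ S with i p = L q, u p)).prod =
      ∑ r : Fin l → Fin d, if (∀ q, r q ∈ S) ∧ ∀ q, i (r q) = L q then
        (List.ofFn fun q => ρ (u (r q))).prod else 0 := by
    intro S
    simp only [map_sum]
    rw [← MultilinearMap.mkPiAlgebraFin_apply (R := Φ),
      MultilinearMap.map_sum_finset (MultilinearMap.mkPiAlgebraFin Φ l B)
        (fun _ p => ρ (u p)) (fun q => S.filter fun p => i p = L q), ← Finset.sum_filter]
    refine Finset.sum_congr ?_ fun r _ => MultilinearMap.mkPiAlgebraFin_apply _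
    ext r
    simp [Fintype.mem_piFinset, forall_and]
  simp only [h1, Finset.smul_sum]
  rw [Finset.sum_comm, Finset.sum_filter]
  refine Finset.sum_congr rfl fun r _ => ?_
  by_cases hc : ∀ q, i (r q) = L q
  -- Taking `p` to be the range of `r`, the signed sum over `S` vanishes unless `r` is surjective.
  · have h2 := sum_supersets_neg_one_pow (R := Φ) (fun p : Fin d => ∃ q, r q = p)
    have h3 : ∀ S : Finset (Fin d), (∀ p, (∃ q, r q = p) → p ∈ S) ↔ ∀ q, r q ∈ S := by
      intro S
      simp
    simp only [h3] at h2
    have h4 : ∀ S : Finset (Fin d), ((-1 : Φ) ^ S.card •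
        if (∀ q, r q ∈ S) ∧ ∀ q, i (r q) = L q then (List.ofFn fun q => ρ (u (r q))).prod else 0) =
        ((-1 : Φ) ^ S.card * if ∀ q, r q ∈ S then 1 else 0) •
          (List.ofFn fun q => ρ (u (r q))).prod := by
      intro S
      by_cases hS : ∀ q, r q ∈ S
      · rw [if_pos ⟨hS, hc⟩, if_pos hS, mul_one]
      · rw [if_neg fun h => hS h.1, if_neg hS, mul_zero, zero_smul, smul_zero]
    simp only [h4]
    rw [← Finset.sum_smul, h2]
    by_cases hr : Function.Surjective r
    · have hr' : ∀ p, ∃ q, r q = p := hr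
      rw [if_pos hr', if_pos ⟨hr, hc⟩]
    · have hr' : ¬∀ p, ∃ q, r q = p := hr
      rw [if_neg hr', if_neg fun h => hr h.1, zero_smul]
  · simp [hc]

open Classical in
/-- Multilinearization of the identity `f` along the word `i` with values in `V`. -/
theorem linearized_identity (ρ : V →ₗ[Φ] B) (f : FA Φ)
    (hf : ∀ x : ℕ → V, (f.coeff.sum fun m c => c • ((letters m).map fun j => ρ (x j)).prod) = 0)
    {d : ℕ} (u : Fin d → V) (i : Fin d → ℕ) :
    (f.coeff.sum fun m c => c • ∑ r : Fin (letters m).length → Fin d with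
      Function.Surjective r ∧ ∀ q, i (r q) = (letters m).get q,
        (List.ofFn fun q => ρ (u (r q))).prod) = 0 := by
  -- For each `S`, substitute for the variable `x_j` the sum of those `u p` with `p ∈ S` at which
  -- the word `i` has letter `j`.
  have h : ∑ S : Finset (Fin d), (-1 : Φ) ^ S.card • (f.coeff.sum fun m c =>
      c • ((letters m).map fun j => ρ (∑ p ∈ S with i p = j, u p)).prod) = 0 :=
    Finset.sum_eq_zero fun S _ => by rw [hf, smul_zero]
  have h2 : (-1 : Φ) ^ d • (f.coeff.sum fun m c => c •
      ∑ r : Fin (letters m).length → Fin d with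
        Function.Surjective r ∧ ∀ q, i (r q) = (letters m).get q,
        (List.ofFn fun q => ρ (u (r q))).prod) = 0 := by
    rw [← h]
    simp only [Finsupp.sum, Finset.smul_sum (N := B)]
    rw [Finset.sum_comm]
    refine Finset.sum_congr rfl fun m _ => ?_
    rw [← Finset.smul_sum, ← Finset.smul_sum, smul_comm, ← sum_neg_one_pow_prod_ofFn,
      Finset.smul_sum]
    refine Finset.sum_congr rfl fun S _ => ?_
    rw [smul_comm]
    congr 3
    conv_rhs => rw [← List.ofFn_get (letters m), List.map_ofFn]
    rfl
  -- The sign `(-1) ^ d` is its own inverse.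
  have h3 := congrArg (fun z => (-1 : Φ) ^ d • z) h2
  simpa [smul_smul, ← mul_pow] using h3

end Linearization
end AssociativePair

/-! ### Density for irreducible modules -/

namespace AssociativePair

/-- The family `v` can be mapped to any family by an element of `Y`. -/
def Interpolates {Φ X Y Z : Type*} [CommRing Φ] [AddCommGroup X] [Module Φ X] [AddCommGroup Y]
    [Module Φ Y] [AddCommGroup Z] [Module Φ Z] (b : X →ₗ[Φ] Y →ₗ[Φ] Z) {n : ℕ} (v : Fin n → X) :
    Prop :=
  ∀ w : Fin n → Z, ∃ y, ∀ i, b (v i) y = w i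

variable {Φ : Type u} {P : Type v} {N : Type w} [CommRing Φ]
  [AddCommGroup P] [Module Φ P] [AddCommGroup N] [Module Φ N]

namespace RightModule

variable {A : AssociativePair Φ P N} {Mp : Type v'} {Mm : Type w'}
    [AddCommGroup Mp] [Module Φ Mp] [AddCommGroup Mm] [Module Φ Mm]

/-- The opposite-sign module over the opposite-sign pair. -/
def swap (M : A.RightModule Mp Mm) : A.swap.RightModule Mm Mp where
  actp := M.actm
  actm := M.actp
  actp_assoc := M.actm_assoc
  actm_assoc := M.actp_assoc

theorem IsIrreducible.swap {M : A.RightModule Mp Mm} (h : M.IsIrreducible) :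
    M.swap.IsIrreducible :=
  ⟨h.2.1, h.1, fun Sp Sm hp hm => (h.2.2 Sm Sp hm hp).imp And.symm And.symm⟩

theorem IsFaithful.swap {M : A.RightModule Mp Mm} (h : M.IsFaithful) : M.swap.IsFaithful :=
  And.symm h

/-- The vectors of `M⁻` killed by `A⁺`, paired with `0 ⊆ M⁺`, form a submodule; it is not all of `M`
because `M⁻A⁺ ≠ 0`. -/
theorem IsIrreducible.exists_actm_ne_zero {M : A.RightModule Mp Mm} (h : M.IsIrreducible)
    {m : Mm} (hm : m ≠ 0) : ∃ x, M.actm m x ≠ 0 := by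
  by_contra! H
  rcases h.2.2 ⊥ (LinearMap.ker M.actm)
    (fun m hm x => by rw [Submodule.mem_bot] at hm; simp [hm])
    (fun m hm x => by
      rw [LinearMap.mem_ker] at hm
      simp [hm]) with h1 | h1
  · refine hm ?_
    have : m ∈ LinearMap.ker M.actm := LinearMap.mem_ker.2 (LinearMap.ext H)
    rwa [h1.2, Submodule.mem_bot] at this
  · obtain ⟨m', x, hx⟩ := h.2.1
    have : m' ∈ LinearMap.ker M.actm := by rw [h1.2]; trivial
    rw [LinearMap.mem_ker] at this
    simp [this] at hx

/-- If some `x` annihilates the family `v` but not `m`, then such `x` map `m` onto everything. -/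
theorem IsIrreducible.exists_annihilating_actm_eq {M : A.RightModule Mp Mm} (h : M.IsIrreducible)
    {ι : Type*} (v : ι → Mm) (m : Mm) (hm : ∃ x, (∀ i, M.actm (v i) x = 0) ∧ M.actm m x ≠ 0)
    (w : Mp) : ∃ x, (∀ i, M.actm (v i) x = 0) ∧ M.actm m x = w := by
  let ann : Submodule Φ P := ⨅ i, LinearMap.ker (M.actm (v i))
  have hann : ∀ x, x ∈ ann ↔ ∀ i, M.actm (v i) x = 0 := by simp [ann]
  -- Since `ann A⁻ A⁺ ⊆ ann`, the image `m · ann` and the vectors of `M⁻` that `A⁺` sends into it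
  -- form a submodule. It is nonzero by `hm`, hence everything.
  let Sp := ann.map (M.actm m)
  let Sm : Submodule Φ Mm := ⨅ x, Sp.comap (M.actm.flip x)
  have hSm : ∀ m', m' ∈ Sm ↔ ∀ x, M.actm m' x ∈ Sp := by simp [Sm]
  obtain ⟨x, hx, hmx⟩ := hm
  rcases h.2.2 Sp Sm (by
      rintro _ ⟨y, hy, rfl⟩ n
      rw [hSm]
      intro z
      rw [M.actm_assoc]
      refine Submodule.mem_map_of_mem ((hann _).2 fun i => ?_)
      rw [← M.actm_assoc, (hann y).1 hy i]
      simp) (fun m' hm' x => (hSm m').1 hm' x) with h1 | h1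
  · have : M.actm m x ∈ Sp := Submodule.mem_map_of_mem ((hann x).2 hx)
    rw [h1.1, Submodule.mem_bot] at this
    exact absurd this hmx
  · have : w ∈ Sp := by rw [h1.1]; trivial
    obtain ⟨y, hy, rfl⟩ := this
    exact ⟨y, (hann y).1 hy, rfl⟩

theorem IsIrreducible.exists_actm_eq {M : A.RightModule Mp Mm} (h : M.IsIrreducible)
    {m : Mm} (hm : m ≠ 0) (w : Mp) : ∃ x, M.actm m x = w := by
  obtain ⟨x, hx⟩ := h.exists_actm_ne_zero hm
  obtain ⟨y, -, hy⟩ := h.exists_annihilating_actm_eq (fun i : Empty => i.elim) m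
    ⟨x, fun i => i.elim, hx⟩ w
  exact ⟨y, hy⟩

/-- An interpolating family is either extendable or has zero annihilator. -/
theorem IsIrreducible.extend_interpolates {M : A.RightModule Mp Mm} (h : M.IsIrreducible)
    (hf : M.IsFaithful) {n : ℕ} {v : Fin n → Mm} (hv : Interpolates M.actm v) :
    (∃ v' : Fin (n + 1) → Mm, Interpolates M.actm v') ∨
      ∀ x, (∀ i, M.actm (v i) x = 0) → x = 0 := by
  by_contra! H
  obtain ⟨H, x, hx, hx0⟩ := H
  have : ∃ m, M.actm m x ≠ 0 := by
    by_contra! H'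
    exact hx0 (hf.2 x H')
  obtain ⟨m, hm⟩ := this
  refine H (Fin.cons m v) fun w => ?_
  obtain ⟨y, hy⟩ := hv fun i => w i.succ
  -- First `y` settles the old vectors; `z` kills them and corrects the value at the new vector `m`.
  obtain ⟨z, hz, hmz⟩ := h.exists_annihilating_actm_eq v m ⟨x, hx, hm⟩ (w 0 - M.actm m y)
  refine ⟨y + z, Fin.cases ?_ fun i => ?_⟩
  · simp [hmz]
  · simp [hy, hz]

end RightModule
end AssociativePair

/-! ### The action of a homotope and the staircase of matrix units -/

namespace AssociativePair

variable {Φ : Type u} {P : Type v} {N : Type w} [CommRing Φ]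
  [AddCommGroup P] [Module Φ P] [AddCommGroup N] [Module Φ N]

namespace RightModule

variable {A : AssociativePair Φ P N} {Mp : Type v'} {Mm : Type w'}
    [AddCommGroup Mp] [Module Φ Mp] [AddCommGroup Mm] [Module Φ Mm]

/-- The right action `m ↦ m x a` of the homotope `(A⁺)^{(a)}` on `M⁻`. -/
def homotopeAct (M : A.RightModule Mp Mm) (a : N) : P →ₗ[Φ] (Module.End Φ Mm)ᵐᵒᵖ where
  toFun x := MulOpposite.op (M.actp.flip a ∘ₗ M.actm.flip x)
  map_add' x y := by
    refine MulOpposite.unop_injective (LinearMap.ext fun m => ?_)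
    simp
  map_smul' c x := by
    refine MulOpposite.unop_injective (LinearMap.ext fun m => ?_)
    simp

theorem homotopeAct_apply (M : A.RightModule Mp Mm) (a : N) (x : P) (m : Mm) :
    (M.homotopeAct a x).unop m = M.actp (M.actm m x) a := rfl

theorem homotopeAct_tp (M : A.RightModule Mp Mm) (a : N) (x y : P) :
    M.homotopeAct a (A.tp x a y) = M.homotopeAct a x * M.homotopeAct a y := by
  refine MulOpposite.unop_injective (LinearMap.ext fun m => ?_)
  rw [MulOpposite.unop_mul, Module.End.mul_apply]
  simp only [homotopeAct_apply, M.actm_assoc]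

theorem homotopeAct_foldl (M : A.RightModule Mp Mm) (a : N) (x : ℕ → P) (l : List ℕ) (z : P) :
    M.homotopeAct a (l.foldl (fun y j => A.tp y a (x j)) z) =
      M.homotopeAct a z * (l.map fun j => M.homotopeAct a (x j)).prod := by
  induction l generalizing z with
  | nil => simp
  | cons j l ih => rw [List.foldl_cons, ih, homotopeAct_tp, List.map_cons, List.prod_cons, mul_assoc]

/-- Moves the identity from the nonunital homotope into a unital endomorphism ring, where it can be
linearized. The opposite ring makes words act from left to right. -/
theorem homotopeAct_homotopeEval (M : A.RightModule Mp Mm) (a : N) (x : ℕ → P) (f : FA Φ) :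
    M.homotopeAct a (A.homotopeEval f a x) = f.coeff.sum fun m c =>
      c • ((letters m).map fun j => M.homotopeAct a (x j)).prod := by
  have h : A.homotopeEval f a x = f.coeff.sum fun m c =>
      c • m.tail.foldl (fun y j => A.tp y a (x j)) (x m.head) := rfl
  rw [h, Finsupp.sum, Finsupp.sum, map_sum]
  refine Finset.sum_congr rfl fun m _ => ?_
  rw [map_smul, homotopeAct_foldl, letters, List.map_cons, List.prod_cons]

section Staircase

variable {M : A.RightModule Mp Mm} {a : N} {d : ℕ} {x : Fin d → P} {m : ℕ → Mm}

/-- The unit `x p` acts as `e_{⌊p/2⌋, ⌊(p+1)/2⌋}`, so in a product not killing `m s` the indices of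
consecutive units must match. -/
theorem isChain_of_staircase_ne_zero
    (hx : ∀ p : Fin d, ∀ j ≤ d / 2, M.actp (M.actm (m j) (x p)) a =
      if j = (p : ℕ) / 2 then m ((p + 1) / 2) else 0) (l : List (Fin d)) :
    ∀ s ≤ d / 2, ((l.map fun p => M.homotopeAct a (x p)).prod).unop (m s) ≠ 0 →
      (∀ p ∈ l.head?, s = (p : ℕ) / 2) ∧
        l.IsChain fun p q : Fin d => ((p : ℕ) + 1) / 2 = (q : ℕ) / 2 := by
  induction l with
  | nil => simp
  | cons p l ih =>
    intro s hs h
    rw [List.map_cons, List.prod_cons, MulOpposite.unop_mul, Module.End.mul_apply,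
      homotopeAct_apply, hx p s hs] at h
    split_ifs at h with hsp
    · have hp : ((p : ℕ) + 1) / 2 ≤ d / 2 := Nat.div_le_div_right p.2
      obtain ⟨h1, h2⟩ := ih _ hp h
      refine ⟨by simpa using hsp, ?_⟩
      rw [List.isChain_cons]
      exact ⟨fun q hq => h1 q hq, h2⟩
    · simp at h

theorem staircase_apply
    (hx : ∀ p : Fin d, ∀ j ≤ d / 2, M.actp (M.actm (m j) (x p)) a =
      if j = (p : ℕ) / 2 then m ((p + 1) / 2) else 0) (k : ℕ) (hk : k ≤ d) :
    ((List.ofFn fun q : Fin k => M.homotopeAct a (x (q.castLE hk))).prod).unop (m 0) =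
      m (k / 2) := by
  induction k with
  | zero => simp
  | succ k ih =>
    rw [List.ofFn_succ', List.concat_eq_append, List.prod_append, List.prod_singleton,
      MulOpposite.unop_mul, Module.End.mul_apply]
    have := ih (Nat.le_of_succ_le hk)
    simp only [Fin.castLE_castSucc]
    rw [this, homotopeAct_apply, hx _ _ (Nat.div_le_div_right (Nat.le_of_succ_le hk))]
    simp

/-- In a product of all staircase units the order is forced. -/
theorem val_eq_of_staircase_ne_zero
    (hx : ∀ p : Fin d, ∀ j ≤ d / 2, M.actp (M.actm (m j) (x p)) a =
      if j = (p : ℕ) / 2 then m ((p + 1) / 2) else 0) {k : ℕ} (hk : k ≤ d) (r : Fin k → Fin d)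
    (hr : Function.Surjective r)
    (h : ((List.ofFn fun q => M.homotopeAct a (x (r q))).prod).unop (m 0) ≠ 0) :
    k = d ∧ ∀ q, (r q : ℕ) = q := by
  have hkd : k = d := hk.antisymm (by simpa using Fintype.card_le_of_surjective r hr)
  refine ⟨hkd, ?_⟩
  subst hkd
  have hinj : Function.Injective r := Finite.injective_iff_surjective.2 hr
  have hl : (List.ofFn fun q => M.homotopeAct a (x (r q))) =
      (List.ofFn r).map fun p => M.homotopeAct a (x p) := by
    rw [List.map_ofFn]
    rfl
  rw [hl] at h
  have hc := (isChain_of_staircase_ne_zero hx _ 0 (Nat.zero_le _) h).2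
  have hmono : StrictMono r := by
    have hc' : (List.ofFn r).IsChain (· < ·) := by
      rw [List.isChain_iff_getElem] at hc ⊢
      intro i hi
      have h1 := hc i hi
      simp only [List.getElem_ofFn] at h1 ⊢
      -- Matching `(p + 1) / 2 = q / 2` gives `q ≥ p`, with equality possible only for even `p`;
      -- injectivity of `r` excludes equality, so `r` increases.
      have h2 : ¬ (r ⟨i, by simp at hi; omega⟩ : ℕ) = r ⟨i + 1, by simpa using hi⟩ := by
        intro h2
        have := congrArg Fin.val (hinj (Fin.ext h2))
        simp at this
      rw [Fin.lt_def]
      omega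
    have := List.isChain_iff_pairwise.1 hc'
    rw [List.pairwise_ofFn] at this
    exact fun i j hij => this hij
  -- A strictly increasing surjection of `Fin k` is the identity.
  have := (hmono.range_inj strictMono_id).1 (by simp [hr.range_eq])
  simp [this]

/-- A staircase of length `d` is incompatible with an identity of degree `d`. -/
theorem staircase_eq_zero
    (hx : ∀ p : Fin d, ∀ j ≤ d / 2, M.actp (M.actm (m j) (x p)) a =
      if j = (p : ℕ) / 2 then m ((p + 1) / 2) else 0)
    {f : FA Φ} (hf : f.IsMonicOfDegree d) (hA : ∀ y : ℕ → P, A.homotopeEval f a y = 0) :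
    m (d / 2) = 0 := by
  classical
  obtain ⟨hdeg, m0, hm0, hc0⟩ := hf
  have hm0' : (letters m0).length = d := hm0
  have h := linearized_identity (M.homotopeAct a) f
    (fun y => by rw [← homotopeAct_homotopeEval, hA, map_zero]) x
    (fun p => (letters m0).get (p.cast hm0'.symm))
  have h' := congrArg (fun b => LinearMap.applyₗ (R := Φ) (m 0)
    ((MulOpposite.opLinearEquiv Φ).symm b)) h
  simp only [Finsupp.sum, map_sum, map_smul, map_zero] at h'
  rw [Finset.sum_eq_single m0] at h'
  -- The monic word `m0` contributes only the ordered product, with coefficient `1`.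
  · rw [hc0, one_smul, Finset.sum_eq_single fun q => q.cast hm0'] at h'
    · rw [← h', ← staircase_apply hx d le_rfl]
      subst hm0'
      rfl
    · intro r hr hne
      by_contra h0
      refine hne (funext fun q => Fin.ext ?_)
      exact (val_eq_of_staircase_ne_zero hx hm0'.le r (Finset.mem_filter.1 hr).2.1 h0).2 q
    · intro hr
      refine absurd (Finset.mem_filter.2 ⟨Finset.mem_univ _, fun p => ⟨p.cast hm0'.symm, ?_⟩,
        fun q => ?_⟩) hr <;> simp
  -- A surviving term would have length `d` and the same letters in the same order as `m0`. Shorter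
  -- words drop out because they cannot involve all `d` units.
  · intro m1 hm1 hne
    rw [Finset.sum_eq_zero, smul_zero]
    intro r hr
    by_contra h0
    obtain ⟨-, hsurj, hr⟩ := Finset.mem_filter.1 hr
    obtain ⟨hlen, hval⟩ := val_eq_of_staircase_ne_zero hx
      (hdeg m1 (Finsupp.mem_support_iff.1 hm1)) r hsurj h0
    refine hne (letters_injective (List.ext_get (hlen.trans hm0'.symm) fun n h1 h2 => ?_))
    rw [← hr ⟨n, h1⟩]
    congr 1
    exact Fin.ext (hval ⟨n, h1⟩)
  · intro hm
    rw [Finsupp.notMem_support_iff.1 hm, zero_smul]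

end Staircase

theorem not_interpolates_of_identity {M : A.RightModule Mp Mm} (hM : M.IsIrreducible) {d : ℕ}
    {f : FA Φ} (hf : f.IsMonicOfDegree d) (hA : A.IsHomotopeIdentity f)
    {m : Fin (d / 2 + 1) → Mm} (hm : Interpolates M.actm m)
    {n : Fin (d / 2 + 1) → Mp} (hn : Interpolates M.actp n) : False := by
  obtain ⟨a, ha⟩ := hn m
  -- As `p < d`, the index `(p + 1) / 2` is at most `d / 2`, so `Fin.ofNat` does not wrap around.
  have hx : ∀ p : Fin d, ∃ x, ∀ i : Fin (d / 2 + 1), M.actm (m i) x =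
      if (i : ℕ) = (p : ℕ) / 2 then n (Fin.ofNat _ ((p + 1) / 2)) else 0 := fun p => hm _
  choose x hx using hx
  have h0 := staircase_eq_zero (M := M) (a := a) (x := x)
    (m := fun j => m (Fin.ofNat (d / 2 + 1) j)) (fun p j hj => by
      rw [hx p]
      have : ((Fin.ofNat (d / 2 + 1) j : Fin _) : ℕ) = j := Nat.mod_eq_of_lt (by omega)
      rw [this]
      split_ifs
      · rw [ha]
      · simp) hf (hA.1 a)
  -- A member of an interpolating family can be sent to a nonzero vector, so it is not zero.
  obtain ⟨z, y, hzy⟩ := hM.2.1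
  obtain ⟨t, ht⟩ := hm fun _ => M.actm z y
  apply hzy
  rw [← ht, h0]
  simp

end RightModule
end AssociativePair

/-! ### Division idempotents and frames from module data -/

namespace AssociativePair

variable {Φ : Type u} {P : Type v} {N : Type w} [CommRing Φ]
  [AddCommGroup P] [Module Φ P] [AddCommGroup N] [Module Φ N]

theorem IsFrame.swap {A : AssociativePair Φ P N} {n : ℕ} {e : Fin n → P × N} (h : A.IsFrame e) :
    A.swap.IsFrame fun i => (e i).swap :=
  ⟨fun i => ⟨(h.1 i).1.symm, fun h0 => (h.1 i).2.1 (Prod.swap_injective h0),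
      (h.1 i).2.2.2, (h.1 i).2.2.1⟩,
    fun i j hij => (h.2.1 i j hij).symm, h.2.2.2, h.2.2.1⟩

namespace RightModule

variable {A : AssociativePair Φ P N} {Mp : Type v'} {Mm : Type w'}
    [AddCommGroup Mp] [Module Φ Mp] [AddCommGroup Mm] [Module Φ Mm]
    {M : A.RightModule Mp Mm}

theorem IsFaithful.ext_actm (h : M.IsFaithful) {x y : P} (hxy : ∀ m, M.actm m x = M.actm m y) :
    x = y :=
  sub_eq_zero.1 (h.2 _ fun m => by rw [map_sub, hxy, sub_self])

theorem IsFaithful.ext_actp (h : M.IsFaithful) {x y : N} (hxy : ∀ m, M.actp m x = M.actp m y) :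
    x = y :=
  sub_eq_zero.1 (h.1 _ fun m => by rw [map_sub, hxy, sub_self])

/-- An element `x` of `A₁₁(e)` with a two-sided inverse `x'` induces a bijection. -/
theorem IsFaithful.bijOn_of_inverse (h : M.IsFaithful) {e : P × N} (he : A.IsIdempotent e)
    {x : P} (hx : x ∈ A.peirceOne e) {x' : N} (hx' : x' ∈ A.swap.peirceOne e.swap)
    (h1 : A.tp x x' e.1 = e.1) (h2 : A.tm x' x e.2 = e.2) :
    Set.BijOn (fun y => A.tp x y x) (A.swap.peirceOne e.swap) (A.peirceOne e) := by
  obtain ⟨p, q⟩ := e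
  obtain ⟨hp, hq⟩ := he
  obtain ⟨s, hs⟩ := hx
  obtain ⟨t, ht⟩ := hx'
  change P at t
  replace ht : x' = A.tm q t q := ht
  simp only at hp hq hs h1 h2
  have kp : ∀ m, M.actm (M.actp (M.actm m p) q) p = M.actm m p := fun m => by
    rw [M.actm_assoc, hp]
  have kq : ∀ m, M.actp (M.actm (M.actp m q) p) q = M.actp m q := fun m => by
    rw [M.actp_assoc, hq]
  have k1 : ∀ m, M.actm (M.actp (M.actm m x) x') p = M.actm m p := fun m => by
    rw [M.actm_assoc, h1]
  have k2 : ∀ m, M.actp (M.actm (M.actp m x') x) q = M.actp m q := fun m => by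
    rw [M.actp_assoc, h2]
  have kx : ∀ m, M.actm (M.actp (M.actm m x) q) p = M.actm m x := fun m => by
    simp only [hs, ← M.actm_assoc, kp]
  have kx' : ∀ m, M.actp (M.actm (M.actp m x') p) q = M.actp m x' := fun m => by
    simp only [ht, ← M.actp_assoc, kq]
  have k3 : ∀ m, M.actp (M.actm (M.actp m q) x) x' = M.actp m q := fun m => by
    rw [← kx', k1, kq]
  have k4 : ∀ m, M.actm (M.actp (M.actm m p) x') x = M.actm m p := fun m => by
    rw [← kx, k2, kp]
  refine ⟨?_, ?_, ?_⟩
  · rintro y -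
    refine ⟨A.tm (A.tm s p y) p s, h.ext_actm fun m => ?_⟩
    simp only [hs, ← M.actm_assoc, ← M.actp_assoc]
  -- The map `z ↦ x' z x'` inverts `y ↦ x y x`; it also supplies the preimages for surjectivity.
  · have key : ∀ y ∈ A.swap.peirceOne (p, q).swap, A.tm (A.tm x' x y) x x' = y := by
      rintro _ ⟨y, rfl⟩
      refine h.ext_actp fun m => ?_
      change M.actp m (A.tm (A.tm x' x (A.tm q y q)) x x') = M.actp m (A.tm q y q)
      simp only [← M.actp_assoc, k2, k3]
    intro y hy z hz hyz
    rw [← key y hy, ← key z hz]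
    have hyz' : A.tp x y x = A.tp x z x := hyz
    rw [A.tm_assoc_left, A.tm_assoc_left, hyz']
  · rintro _ ⟨z, rfl⟩
    refine ⟨A.tm x' (A.tp p z p) x', ⟨A.tp (A.tp (A.tp t q (A.tp p z p)) q t) q p, ?_⟩, ?_⟩
    · refine h.ext_actp fun m => ?_
      change _ = M.actp m (A.tm q _ q)
      simp only [ht, ← M.actm_assoc, ← M.actp_assoc, kq]
    · refine h.ext_actm fun m => ?_
      simp only [← M.actm_assoc, ← M.actp_assoc, k1, k4]

/-- One-sided inverses suffice: the right inverse of a nonzero element is nonzero, so it has a right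
inverse too, and both inverses are then two-sided. Identities are checked on the faithful module,
where products become words. -/
theorem IsFaithful.isDivisionIdempotent (h : M.IsFaithful) {p : P} {q : N}
    (he : A.IsIdempotent (p, q)) (h0 : q ≠ 0)
    (hinv : ∀ y : N, A.tp p y p ≠ 0 → ∃ z : P, A.tm q (A.tp p y p) (A.tm q z q) = q) :
    A.IsDivisionIdempotent (p, q) := by
  obtain ⟨hp, hq⟩ := id he
  simp only at hp hq
  have kp : ∀ m, M.actm (M.actp (M.actm m p) q) p = M.actm m p := fun m => by
    rw [M.actm_assoc, hp]
  have kq : ∀ m, M.actp (M.actm (M.actp m q) p) q = M.actp m q := fun m => by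
    rw [M.actp_assoc, hq]
  have key : ∀ y : N, A.tp p y p ≠ 0 → ∃ z : P, A.tp (A.tp p y p) (A.tm q z q) p = p ∧
      A.tm (A.tm q z q) (A.tp p y p) q = q := by
    intro y hy
    obtain ⟨z, hz⟩ := hinv y hy
    have kz : ∀ m, M.actp (M.actm (M.actp (M.actm (M.actp (M.actm (M.actp m q) p) y) p) q) z) q =
        M.actp m q := fun m => by
      conv_rhs => rw [← hz]
      simp only [← M.actm_assoc, ← M.actp_assoc]
    have hz0 : A.tp p (A.tm q z q) p ≠ 0 := by
      intro h1
      refine h0 (h.ext_actp fun m => ?_)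
      have k0 : ∀ m, M.actm (M.actp (M.actm (M.actp (M.actm m p) q) z) q) p = 0 := fun m => by
        have := congrArg (M.actm m) h1
        simpa only [← M.actm_assoc, ← M.actp_assoc, map_zero] using this
      rw [← kz m, ← kq]
      rw [k0]
      simp
    obtain ⟨z', hz'⟩ := hinv _ hz0
    have kz' : ∀ m, M.actp (M.actm (M.actp (M.actm (M.actp (M.actm (M.actp m q) z) q) p) q) z') q =
        M.actp m q := fun m => by
      conv_rhs => rw [← hz']
      simp only [← M.actm_assoc, ← M.actp_assoc, kq]
    have k1 : ∀ m, M.actm (M.actp (M.actm (M.actp (M.actm (M.actp (M.actm m p) y) p) q) z) q) p =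
        M.actm m p := fun m => by
      have := congrArg (fun n => M.actm n p) (kz (M.actm m p))
      simpa only [kp] using this
    refine ⟨z, h.ext_actm fun m => ?_, h.ext_actp fun m => ?_⟩
    · simp only [← M.actm_assoc, ← M.actp_assoc, k1]
    · simp only [← M.actm_assoc, ← M.actp_assoc]
      rw [← kz' (M.actm (M.actp (M.actm (M.actp (M.actm (M.actp m q) z) q) p) y) p)]
      rw [← kq (M.actm (M.actp (M.actm (M.actp (M.actm (M.actp (M.actm (M.actp m q) z) q) p) y) p)
          q) z),
        k1, kq, kz']
  refine ⟨he, fun h1 => h0 (congrArg Prod.snd h1), ?_, ?_⟩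
  · rintro _ ⟨y, rfl⟩ hy
    obtain ⟨z, h1, h2⟩ := key y hy
    exact h.bijOn_of_inverse he ⟨y, rfl⟩ ⟨z, rfl⟩ h1 h2
  · rintro _ ⟨y, rfl⟩ hy
    -- The other sign is reduced to the first by carrying `A₁₁⁻` into `A₁₁⁺` through `p · p`.
    have hy' : A.tp p (A.tm q y q) p ≠ 0 := by
      intro h1
      apply hy
      refine h.ext_actp fun m => ?_
      have k0 : ∀ m, M.actm (M.actp (M.actm (M.actp (M.actm m p) q) y) q) p = 0 := fun m => by
        have := congrArg (M.actm m) h1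
        simpa only [← M.actm_assoc, ← M.actp_assoc, map_zero] using this
      change M.actp m (A.tm q y q) = _
      rw [← M.actp_assoc, ← kq m, ← kq (M.actm (M.actp (M.actm (M.actp m q) p) q) y), k0]
      simp
    obtain ⟨z, h1, h2⟩ := key _ hy'
    have k1 : ∀ m, M.actm (M.actp (M.actm (M.actp (M.actm (M.actp (M.actm (M.actp (M.actm m p) q) y)
        q) p) q) z) q) p = M.actm m p := fun m => by
      conv_rhs => rw [← h1]
      simp only [← M.actm_assoc, ← M.actp_assoc]
    have k2 : ∀ m, M.actp (M.actm (M.actp (M.actm (M.actp (M.actm (M.actp (M.actm (M.actp m q) z) q)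
        p) q) y) q) p) q = M.actp m q := fun m => by
      conv_rhs => rw [← h2]
      simp only [← M.actm_assoc, ← M.actp_assoc]
    refine IsFaithful.bijOn_of_inverse (M := M.swap) h.swap (e := (q, p)) he.symm ⟨y, rfl⟩
      (x' := A.tp p (A.tm q z q) p) ⟨_, rfl⟩ ?_ ?_
    · refine h.ext_actp fun m => ?_
      change M.actp m (A.tm (A.tm q y q) (A.tp p (A.tm q z q) p) q) = M.actp m q
      have := congrArg (fun n => M.actp n q) (k1 (M.actp m q))
      simp only [kq] at this
      simp only [← M.actm_assoc, ← M.actp_assoc, kq]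
      exact this
    · refine h.ext_actm fun m => ?_
      change M.actm m (A.tp (A.tp p (A.tm q z q) p) (A.tm q y q) p) = M.actm m p
      have := congrArg (fun n => M.actm n p) (k2 (M.actm m p))
      simp only [kp] at this
      simp only [← M.actm_assoc, ← M.actp_assoc]
      exact this

/-- The frame attached to a basis of `M⁺` and an interpolating family of `M⁻`. -/
theorem exists_isFrame (hM : M.IsIrreducible) (h : M.IsFaithful) {n : ℕ}
    {m : Fin n → Mm} (hm : Interpolates M.actm m) {w : Fin n → Mp} (hw : Interpolates M.actp w)
    (hann : ∀ y, (∀ i, M.actp (w i) y = 0) → y = 0) : ∃ e : Fin n → P × N, A.IsFrame e := by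
  have hext : ∀ {y y' : N}, (∀ i, M.actp (w i) y = M.actp (w i) y') → y = y' := fun H =>
    sub_eq_zero.1 (hann _ fun i => by rw [map_sub, H, sub_self])
  -- `E` identifies each `m i` with `w i`, and `q i` sends `w i` back to `m i` and kills the other
  -- `w j`; thus `q i` followed by `E` is a diagonal unit on the `w j`.
  obtain ⟨E, hE⟩ := hm w
  have hq : ∀ i, ∃ y, ∀ j, M.actp (w j) y = if j = i then m i else 0 := fun i => hw _
  choose q hq using hq
  let p : Fin n → P := fun i => A.tp E (q i) E
  have hqEq : ∀ i j, A.tm (q i) E (q j) = if i = j then q i else 0 := by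
    intro i j
    refine hext fun k => ?_
    rw [← M.actp_assoc, hq]
    by_cases hk : k = i
    · subst hk
      by_cases hkj : k = j
      · subst hkj
        simp [hE, hq]
      · simp [hE, hq, hkj]
    · by_cases hij : i = j
      · simp [← hij, hk, hq]
      · simp [hk, hij]
  have hsum : ∀ y, A.tm (∑ i, q i) E y = y := by
    intro y
    refine hext fun k => ?_
    rw [← M.actp_assoc]
    simp [map_sum, hq, hE]
  have kq : ∀ i m, M.actp (M.actm (M.actp m (q i)) E) (q i) = M.actp m (q i) := fun i m => by
    rw [M.actp_assoc, hqEq, if_pos rfl]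
  have kqj : ∀ i j, i ≠ j → ∀ m, M.actp (M.actm (M.actp m (q i)) E) (q j) = 0 :=
    fun i j hij m => by rw [M.actp_assoc, hqEq, if_neg hij, map_zero]
  have hid : ∀ i, A.IsIdempotent (p i, q i) := fun i =>
    ⟨h.ext_actm fun m => by simp only [p, ← M.actm_assoc, kq],
      h.ext_actp fun m => by simp only [p, ← M.actm_assoc, ← M.actp_assoc, kq]⟩
  have hM0 : ∃ z : Mp, z ≠ 0 := hM.2.1.elim fun z ⟨y, hzy⟩ => ⟨M.actm z y, hzy⟩
  have hq0 : ∀ i, q i ≠ 0 := by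
    intro i h0
    obtain ⟨z, hz⟩ := hM0
    obtain ⟨t, ht⟩ := hm fun _ => z
    have h1 := hq i i
    rw [h0, map_zero, if_pos rfl] at h1
    exact hz (by rw [← ht i, ← h1, LinearMap.map_zero₂])
  refine ⟨fun i => (p i, q i), fun i => ?_, fun i j hij => ⟨⟨?_, ?_⟩, ?_, ?_⟩, ?_, ?_⟩
  · refine h.isDivisionIdempotent (hid i) (hq0 i) fun y hy => ?_
    -- Otherwise `q i (p i y p i) q i` kills every `w k`, hence is zero, and multiplying by `E` on
    -- both sides gives `p i y p i = 0`.
    have hu : M.actp (M.actm (m i) (A.tp (p i) y (p i))) (q i) ≠ 0 := by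
      intro hu
      have h1 : A.tm (q i) (A.tp (p i) y (p i)) (q i) = 0 := by
        refine hext fun k => ?_
        rw [← M.actp_assoc, hq]
        split_ifs
        · simp [hu]
        · simp
      refine hy (h.ext_actm fun n => ?_)
      have h2 := congrArg (fun t => M.actm (M.actp (M.actm n E) t) E) h1
      simpa only [p, ← M.actm_assoc, ← M.actp_assoc, kq, map_zero, LinearMap.zero_apply] using h2
    -- Irreducibility replaces Schur's lemma: the nonzero vector can be returned to `w i`, which
    -- gives a right inverse.
    obtain ⟨z, hz⟩ := hM.exists_actm_eq hu (w i)
    refine ⟨z, hext fun k => ?_⟩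
    rw [← M.actp_assoc, hq, ← M.actp_assoc]
    split_ifs with hk
    · rw [hz, hq, if_pos rfl]
    · simp
  · refine h.ext_actm fun n => ?_
    simp only [p, ← M.actm_assoc, kqj i j hij, map_zero, LinearMap.zero_apply]
  · refine h.ext_actm fun n => ?_
    simp only [p, ← M.actm_assoc, kqj j i hij.symm, map_zero, LinearMap.zero_apply]
  · refine h.ext_actp fun n => ?_
    change M.actp n (A.tm (q i) (p i) (q j)) = _
    simp only [p, ← M.actm_assoc, ← M.actp_assoc, kqj i j hij, map_zero]
  · refine h.ext_actp fun n => ?_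
    change M.actp n (A.tm (q j) (p i) (q i)) = _
    simp only [p, ← M.actm_assoc, ← M.actp_assoc, kqj j i hij.symm, map_zero, LinearMap.zero_apply]
  · intro x hx
    refine h.ext_actm fun n => ?_
    by_contra h0
    -- `hann` concerns only `A⁻`, so for `x ∈ A⁺` the vector `n x` is tested against `z = ∑ (q i) E
    -- z`; the Peirce condition gives `n x (q i) E = 0`.
    obtain ⟨z, hz⟩ := hM.swap.exists_actm_ne_zero (m := M.actm n x)
      (fun h1 => h0 (by rw [h1, map_zero]))
    refine hz ?_
    change M.actp (M.actm n x) z = 0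
    rw [← hsum z, ← M.actp_assoc, map_sum, LinearMap.map_sum₂, LinearMap.map_sum₂]
    refine Finset.sum_eq_zero fun i _ => ?_
    have h1 := congrArg (M.actm n) (hx i).2
    simp only [p, ← M.actm_assoc, kq, map_zero] at h1
    rw [h1, LinearMap.map_zero₂]
  · intro y hy
    refine hann y fun i => ?_
    have h1 : A.tm (q i) (p i) y = 0 := (hy i).1
    have h2 := congrArg (M.actp (w i)) h1
    simpa only [p, ← M.actm_assoc, ← M.actp_assoc, hq, hE, if_true, map_zero] using h2

end RightModule
end AssociativePair

/-! ### Choice of the frame length and conclusion -/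

namespace AssociativePair

variable {Φ : Type u} {P : Type v} {N : Type w} [CommRing Φ]
  [AddCommGroup P] [Module Φ P] [AddCommGroup N] [Module Φ N]

theorem RightModule.exists_isFrame_of_identity {A : AssociativePair Φ P N} {Mp : Type v'}
    {Mm : Type w'} [AddCommGroup Mp] [Module Φ Mp] [AddCommGroup Mm] [Module Φ Mm]
    {M : A.RightModule Mp Mm} (hM : M.IsIrreducible) (h : M.IsFaithful) {d : ℕ} {f : FA Φ}
    (hf : f.IsMonicOfDegree d) (hA : A.IsHomotopeIdentity f) :
    ∃ n ≤ d / 2, ∃ e : Fin n → P × N, A.IsFrame e := by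
  -- `Q` demands both signs at once, so at the last `n` where it holds at least one sign has no
  -- family of size `n + 1`.
  let Q : ℕ → Prop := fun n => (∃ m : Fin n → Mm, Interpolates M.actm m) ∧
    ∃ w : Fin n → Mp, Interpolates M.actp w
  have hQ0 : Q 0 := ⟨⟨Fin.elim0, fun _ => ⟨0, fun i => i.elim0⟩⟩,
    ⟨Fin.elim0, fun _ => ⟨0, fun i => i.elim0⟩⟩⟩
  have hQ : ¬Q (d / 2 + 1) := fun ⟨⟨m, hm⟩, ⟨w, hw⟩⟩ => not_interpolates_of_identity hM hf hA hm hw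
  have : ∃ n ≤ d / 2, Q n ∧ ¬Q (n + 1) := by
    by_contra! H
    have : ∀ n ≤ d / 2 + 1, Q n := fun n => by
      induction n with
      | zero => exact fun _ => hQ0
      | succ n ih => exact fun hn => H n (by omega) (ih (by omega))
    exact hQ (this _ le_rfl)
  obtain ⟨n, hn, ⟨⟨m, hm⟩, ⟨w, hw⟩⟩, hQn⟩ := this
  refine ⟨n, hn, ?_⟩
  have hw' : Interpolates M.swap.actm w := hw
  rcases hM.extend_interpolates h hm with h1 | h1
  · rcases hM.swap.extend_interpolates h.swap hw' with h2 | h2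
    · exact absurd ⟨h1, h2⟩ hQn
    · exact exists_isFrame hM h hm hw h2
  -- Here the family in `M⁻` has zero annihilator, so the frame is built in the opposite pair and
  -- swapped back.
  · obtain ⟨e, he⟩ := exists_isFrame hM.swap h.swap hw' (w := m) hm h1
    exact ⟨_, he.swap⟩

end AssociativePair

theorem mainTheorem6 {Φ : Type u} {P : Type v} {N : Type w} [CommRing Φ]
    [AddCommGroup P] [Module Φ P] [AddCommGroup N] [Module Φ N]
    (A : AssociativePair Φ P N) (hA : AssociativePair.IsPrimitive.{u, v, w, v', w'} A)
    (d : ℕ) (hd : A.SatisfiesHPI d) :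
    ∃ c : ℕ, A.capacity = (c : ℕ∞) ∧ c ≤ d / 2 := by
  obtain ⟨Mp, Mm, _, _, _, _, M, hM, h⟩ := hA
  obtain ⟨f, hf, hid⟩ := hd
  obtain ⟨n, hn, e, he⟩ := AssociativePair.RightModule.exists_isFrame_of_identity hM h hf hid
  have hle : A.capacity ≤ (n : ℕ∞) := sInf_le ⟨n, e, he, rfl⟩
  obtain ⟨c, hc⟩ := ENat.ne_top_iff_exists.1 (ne_top_of_le_ne_top (ENat.natCast_ne_top n) hle)
  refine ⟨c, hc.symm, le_trans ?_ hn⟩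
  rw [← hc] at hle
  exact_mod_cast hle
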